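/- Say that a cumulative distribution function $F$ is of class $\mathcal C$ with tail exponent $n>0$ if $F$ is continuous, $F(x)=0$ for $x\le 0$, $F$ is strictly increasing on $(0,\infty)$, there are $\alpha,\beta>0$, $l\in\mathbb R$ and a function $H$ with $H(x)=o(x^n)$ as $x\to\infty$ such that $\lim_{x\to\infty}\frac{1-F(x)}{\alpha x^{l}e^{-\beta x^{n}+H(x)}}=1$, and there are $\eta,\gamma>0$ with $\lim_{x\downarrow 0}\frac{F(x)}{\eta x^{\gamma}}=1$. Let $h_1,h_2,\dots$ be i.i.d. random variables (the power gains of the links from the secondary users to the secondary base station, "STSB") and let $g_1,g_2,\dots$ be i.i.d. random variables (the power gains of the links from the secondary users to the primary base station, "STPB"), the two sequences being independent of each other. Suppose that the distribution function of $h_1$ is of class $\mathcal C$ with tail exponent $n_h$ and that the distribution function of $g_1$ is of class $\mathcal C$ (with some tail exponent). Fix $P_{\rm ave}>0$ and $Q_{\rm ave}>0$. For the network with $N$ secondary users write $\boldsymbol h=(h_1,\dots,h_N)^\top$ and $\boldsymbol g=(g_1,\dots,g_N)^\top$. A power allocation policy is a measurable map $(\boldsymbol h,\boldsymbol g)\mapsto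 \boldsymbol P(\boldsymbol h,\boldsymbol g)\in[0,\infty)^N$. Let $R^{\rm F}(N)$, the sum-rate with full feedback, be the optimal (supremal) value of $$\mathbb E\big[\log\big(1+\boldsymbol h^\top \boldsymbol P(\boldsymbol h,\boldsymbol g)\big)\big]$$ over all policies with $\mathbb E[\sum_{i=1}^N P_i(\boldsymbol h,\boldsymbol g)]\le P_{\rm ave}$ and $\mathbb E[\boldsymbol g^\top \boldsymbol P(\boldsymbol h,\boldsymbol g)]\le Q_{\rm ave}$. For $1\le k\le N$ let $R^{K}(N,k)$, the sum-rate under $k$-smallest-channel-gains ($K$-SCG) feedback, be the optimal value of the same problem under the additional constraint that $P_i(\boldsymbol h,\boldsymbol g)=0$ whenever $g_i>g_{k:N}$, where $g_{k:N}$ is the $k$-th smallest of $g_1,\dots,g_N$. Theorem. All these sum-rates are finite. If $K_N$ are integers with $K_N\to\infty$ and $K_N=o(N)$, then $$\lim_{N\to\infty}\frac{R^{K}(N,K_N)}{\log\log K_N}=\frac1{n_h};$$ moreover $$\lim_{N\to\infty}\frac{R^{\rm F}(N)}{\log\log N}=\frac1{n_h}.$$ Consequently, for $\delta\in(0,1)$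 and integers $K_N$ with $K_N/N^{\delta}\to1$ (that is, $K_N=N^\delta$ up to rounding), $K$-SCG feedback is asymptotically optimal: $R^{K}(N,K_N)/\log\log N\to 1/n_h$ and $R^{K}(N,K_N)/R^{\rm F}(N)\to1$. -/

import Mathlib

open MeasureTheory ProbabilityTheory Filter Topology Asymptotics
open scoped ENNReal

namespace CMAC

/-- The class-`C` distributions.  `F` is a cumulative distribution function, `α, β, n, l, H` describe
its tail at infinity and `η, γ` its behaviour at the origin.  The correction `H` is only required to
be of smaller order than `x ^ n`. -/
structure IsClassC (F : ℝ → ℝ) (α β n l : ℝ) (H : ℝ → ℝ) (η γ : ℝ) : Prop where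
  continuous : Continuous F
  eq_zero : ∀ x : ℝ, x ≤ 0 → F x = 0
  strictMonoOn : StrictMonoOn F (Set.Ioi 0)
  α_pos : 0 < α
  β_pos : 0 < β
  n_pos : 0 < n
  H_isLittleO : H =o[atTop] (fun x : ℝ => x ^ n)
  tail : Tendsto (fun x : ℝ => (1 - F x) / (α * x ^ l * Real.exp (-β * x ^ n + H x)))
    atTop (𝓝 1)
  η_pos : 0 < η
  γ_pos : 0 < γ
  origin : Tendsto (fun x : ℝ => F x / (η * x ^ γ)) (𝓝[>] 0) (𝓝 1)

section Model

variable {Ω : Type*} [MeasurableSpace Ω]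

/-- The fading model: `h i` and `g i` are the power gains of user `i` towards the secondary and the
primary base station.  The `h i` are i.i.d., the `g i` are i.i.d., and the two families are
independent of each other.  The network with `N` users consists of the users `0, …, N - 1`. -/
structure IsFadingModel (μ : Measure Ω) (h g : ℕ → Ω → ℝ) : Prop where
  measurable_h : ∀ i, Measurable (h i)
  measurable_g : ∀ i, Measurable (g i)
  iIndepFun_h : iIndepFun h μ
  iIndepFun_g : iIndepFun g μ
  identDistrib_h : ∀ i, IdentDistrib (h i) (h 0) μ μ
  identDistrib_g : ∀ i, IdentDistrib (g i) (g 0) μ μ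
  indepFun : IndepFun (fun ω i => h i ω) (fun ω i => g i ω) μ

/-- The vector of the first `N` gains. -/
def gains (N : ℕ) (h : ℕ → Ω → ℝ) (ω : Ω) : Fin N → ℝ := fun i => h i ω

/-- A power allocation policy for `N` users: it maps the pair `(h, g)` of gain vectors to the vector
of transmit powers. -/
abbrev Policy (N : ℕ) : Type := (Fin N → ℝ) × (Fin N → ℝ) → Fin N → ℝ

/-- The `k`-th smallest of the numbers `y 0, …, y (N - 1)`, for `1 ≤ k ≤ N`
(the value for other `k` is irrelevant). -/
noncomputable def orderStat {N : ℕ} (y : Fin N → ℝ) (k : ℕ) : ℝ :=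
  if hk : k - 1 < N then y (Tuple.sort y ⟨k - 1, hk⟩) else 0

/-- Feasible policies of the total-power-and-interference-limited network with full feedback:
nonnegative powers, average total power at most `Pave`, average total interference power at the
primary base station at most `Qave`.  (The averaged quantities are almost surely nonnegative, so the
Lebesgue integral is the expectation.) -/
structure IsFeasible (μ : Measure Ω) (h g : ℕ → Ω → ℝ) (Pave Qave : ℝ) (N : ℕ)
    (P : Policy N) : Prop where
  measurable : Measurable P
  nonneg : ∀ z i, 0 ≤ P z i
  power : ∫⁻ ω, ENNReal.ofReal (∑ i, P (gains N h ω, gains N g ω) i) ∂μ ≤ ENNReal.ofReal Pave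
  interference : ∫⁻ ω, ENNReal.ofReal (∑ i, gains N g ω i * P (gains N h ω, gains N g ω) i) ∂μ
    ≤ ENNReal.ofReal Qave

/-- The feedback constraint of the `k`-smallest-channel-gains protocol: user `i` stays silent
whenever its gain to the primary base station exceeds the `k`-th smallest one. -/
def SatisfiesFeedback (N k : ℕ) (P : Policy N) : Prop :=
  ∀ (x y : Fin N → ℝ) (i : Fin N), orderStat y k < y i → P (x, y) i = 0

/-- The ergodic sum-rate `E[log (1 + hᵀ P(h, g))]` of a policy. -/
noncomputable def ergodicRate (μ : Measure Ω) (h g : ℕ → Ω → ℝ) (N : ℕ) (P : Policy N) : ℝ≥0∞ :=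
  ∫⁻ ω, ENNReal.ofReal
    (Real.log (1 + ∑ i, gains N h ω i * P (gains N h ω, gains N g ω) i)) ∂μ

/-- The optimal sum-rate of the `N`-user network with full feedback. -/
noncomputable def rateFull (μ : Measure Ω) (h g : ℕ → Ω → ℝ) (Pave Qave : ℝ) (N : ℕ) : ℝ≥0∞ :=
  ⨆ (P : Policy N) (_ : IsFeasible μ h g Pave Qave N P), ergodicRate μ h g N P

/-- The optimal sum-rate of the `N`-user network under `k`-smallest-channel-gains feedback. -/
noncomputable def rateSCG (μ : Measure Ω) (h g : ℕ → Ω → ℝ) (Pave Qave : ℝ) (N k : ℕ) : ℝ≥0∞ :=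
  ⨆ (P : Policy N) (_ : IsFeasible μ h g Pave Qave N P ∧ SatisfiesFeedback N k P),
    ergodicRate μ h g N P

end Model

end CMAC

/-!
Both scaling laws say that the rate is `(1 / nh) log log k + O(1)` from above and
`(1 / nh) log log k (1 + o(1))` from below, where `k` users report; full feedback is the case
`k = N` of the upper bound.

*Upper bound* (`exists_rateSCG_le`). For nonnegative powers `hᵀP` is at most `M ∑ Pᵢ`, with `M` the
largest gain among the users that may transmit, so `log (1 + hᵀP) ≤ log (1 + M) + ∑ Pᵢ`, and the last
term has mean at most `Pave`. The variable `exp (s h ^ nh)` is integrable for `s = βh / 4`, and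
`s M ^ nh ≤ log k + (∑ exp (s hᵢ ^ nh)) / k`, the sum being over the users that may transmit. These
are almost surely exactly `k` users, since `g` has a continuous distribution, and they are chosen
independently of `h`; hence the sum divided by `k` has bounded mean, and
`E log (1 + M) ≤ (1 / nh) log (1 + log k) + O(1)` (`log_one_add_sum_mul_le`,
`lintegral_sum_feedback_le`).

*Lower bound* (`le_rateSCG`, `one_sub_le_measure_activeUsers`). Share a constant power
`p = min Pave Qave` among the reporting users with `gᵢ ≤ 1` and `hᵢ > t`; both constraints then hold
trivially, and the rate is at least `log (1 + p t)` times the probability that somebody transmits.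
By the law of large numbers more than `k = o(N)` users have `gᵢ ≤ 1`, so that all reporting users do,
and for `t = (log k / (4 βh)) ^ (1 / nh)` one of `k` independent gains exceeds `t` except with
probability `exp (-√k)`. This `t` gives `log (1 + p t) ~ (1 / nh) log log k`.

For full feedback the lower bound comes from the feasible policies with `⌊√N⌋` reporting users,
since `log log` does not see powers: `log log (N ^ δ) = log log N + log δ`.
-/

namespace CMAC

/-! ### Tails and exponential moments of class-`C` distributions -/

/-- Polynomial factors and the correction `H` are negligible: up to a factor `2`, the tail of a
class-`C` distribution lies between `exp (-2βxⁿ)` and `exp (-βxⁿ/2)`. -/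
theorem IsClassC.eventually_tail_bounds {F H : ℝ → ℝ} {α β n l η γ : ℝ}
    (hF : IsClassC F α β n l H η γ) :
    ∀ᶠ x in atTop, 1 - F x ≤ Real.exp (-(β / 2) * x ^ n) ∧
      Real.exp (-(2 * β) * x ^ n) ≤ 1 - F x := by
  have hβ := hF.β_pos
  have hα := hF.α_pos
  have h1 : (fun x : ℝ => Real.log x) =o[atTop] (fun x : ℝ => x ^ n) :=
    isLittleO_log_rpow_atTop hF.n_pos
  have h2 : (fun _ : ℝ => |Real.log α| + Real.log 2) =o[atTop] (fun x : ℝ => x ^ n) := by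
    rw [isLittleO_const_left]
    right
    exact tendsto_norm_atTop_atTop.comp (tendsto_rpow_atTop hF.n_pos)
  have e1 := (h1.const_mul_left l).bound (show (0 : ℝ) < β / 6 by positivity)
  have e2 := h2.bound (show (0 : ℝ) < β / 6 by positivity)
  have e3 := hF.H_isLittleO.bound (show (0 : ℝ) < β / 6 by positivity)
  have e4 := hF.tail.eventually (Icc_mem_nhds (show (1 / 2 : ℝ) < 1 by norm_num)
    (show (1 : ℝ) < 2 by norm_num))
  filter_upwards [e1, e2, e3, e4, eventually_gt_atTop 0] with x a1 a2 a3 a4 hx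
  have hxn : 0 < x ^ n := Real.rpow_pos_of_pos hx n
  rw [Real.norm_eq_abs, Real.norm_of_nonneg hxn.le] at a1 a2 a3
  have hE : α * x ^ l * Real.exp (-β * x ^ n + H x)
      = Real.exp (Real.log α + l * Real.log x + (-β * x ^ n + H x)) := by
    rw [Real.exp_add (_ + _), Real.exp_add (Real.log α), Real.exp_log hα, Real.rpow_def_of_pos hx,
      mul_comm l]
  rw [hE] at a4
  obtain ⟨b1, b2⟩ := a4
  rw [div_le_iff₀ (Real.exp_pos _)] at b2
  rw [le_div_iff₀ (Real.exp_pos _)] at b1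
  have c1 := abs_le.1 a1
  have c3 := abs_le.1 a3
  have c2 := (le_abs_self _).trans a2
  have cα := abs_le.1 (le_refl |Real.log α|)
  have l2 : 0 < Real.log 2 := Real.log_pos (by norm_num)
  have p2 : (2 : ℝ) = Real.exp (Real.log 2) := (Real.exp_log (by norm_num)).symm
  constructor
  · refine b2.trans ?_
    nth_rewrite 1 [p2]
    rw [← Real.exp_add, Real.exp_le_exp]
    linarith
  · refine le_trans ?_ b1
    have : (1 / 2 : ℝ) = Real.exp (-Real.log 2) := by
      rw [Real.exp_neg, Real.exp_log (by norm_num)]; norm_num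
    rw [this, ← Real.exp_add, Real.exp_le_exp]
    have : 0 < β * x ^ n := by positivity
    linarith

theorem measure_Ioi_eq_ofReal_one_sub_cdf (ν : Measure ℝ) [IsProbabilityMeasure ν] (x : ℝ) :
    ν (Set.Ioi x) = ENNReal.ofReal (1 - cdf ν x) := by
  rw [cdf_eq_real, ← probReal_compl_eq_one_sub measurableSet_Iic, Set.compl_Iic,
    ofReal_measureReal]

theorem IsClassC.ae_pos {ν : Measure ℝ} [IsProbabilityMeasure ν] {H : ℝ → ℝ}
    {α β n l η γ : ℝ} (hF : IsClassC (cdf ν) α β n l H η γ) : ∀ᵐ x ∂ν, 0 < x := by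
  have h0 := hF.eq_zero 0 le_rfl
  rw [cdf_eq_real, measureReal_eq_zero_iff] at h0
  rw [ae_iff]
  simp only [not_lt]
  exact h0

theorem IsClassC.measure_singleton {ν : Measure ℝ} [IsProbabilityMeasure ν] {H : ℝ → ℝ}
    {α β n l η γ : ℝ} (hF : IsClassC (cdf ν) α β n l H η γ) (x : ℝ) : ν {x} = 0 := by
  have := (cdf ν).measure_singleton x
  rw [measure_cdf, hF.continuous.continuousAt.continuousWithinAt.leftLim_eq] at this
  simpa using this

theorem IsClassC.cdf_pos {ν : Measure ℝ} [IsProbabilityMeasure ν] {H : ℝ → ℝ}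
    {α β n l η γ : ℝ} (hF : IsClassC (cdf ν) α β n l H η γ) {x : ℝ} (hx : 0 < x) :
    0 < cdf ν x :=
  (cdf_nonneg ν (x / 2)).trans_lt
    (hF.strictMonoOn (show 0 < x / 2 by positivity) hx (by linarith))

/-- The `n`-th power of a class-`C` variable has a finite exponential moment. -/
theorem IsClassC.lintegral_exp_lt_top {ν : Measure ℝ} [IsProbabilityMeasure ν] {H : ℝ → ℝ}
    {α β n l η γ : ℝ} (hF : IsClassC (cdf ν) α β n l H η γ) :
    ∫⁻ x, ENNReal.ofReal (Real.exp (β / 4 * x ^ n)) ∂ν < ∞ := by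
  have hβ := hF.β_pos
  have hn := hF.n_pos
  have hy : Tendsto (fun t : ℝ => (Real.log t / (β / 4)) ^ n⁻¹) atTop atTop :=
    (tendsto_rpow_atTop (inv_pos.2 hn)).comp (Real.tendsto_log_atTop.atTop_div_const (by positivity))
  obtain ⟨u, hu⟩ := eventually_atTop.1
    ((hy.eventually hF.eventually_tail_bounds).and (eventually_ge_atTop 1))
  have hu1 : 1 ≤ u := (hu u le_rfl).2
  rw [lintegral_eq_lintegral_meas_lt ν (ae_of_all _ fun x => (Real.exp_pos _).le)
    (by fun_prop)]
  -- The tail exponent `β / 2` is twice the rate `β / 4`, so the level sets decay like `t ^ (-2)`.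
  have key : ∀ t ∈ Set.Ioi u, ν {a | t < Real.exp (β / 4 * a ^ n)} ≤
      ENNReal.ofReal (t ^ (-2 : ℝ)) := by
    intro t ht
    obtain ⟨⟨ht1, -⟩, ht2⟩ := hu t (Set.mem_Ioi.1 ht).le
    have ht0 : 0 < t := by linarith
    have hL : 0 ≤ Real.log t / (β / 4) := div_nonneg (Real.log_nonneg ht2) (by positivity)
    calc ν {a | t < Real.exp (β / 4 * a ^ n)}
        ≤ ν (Set.Ioi ((Real.log t / (β / 4)) ^ n⁻¹)) := by
          apply measure_mono_ae
          filter_upwards [hF.ae_pos] with a ha hta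
          have h1 : Real.log t < β / 4 * a ^ n := (Real.log_lt_iff_lt_exp ht0).2 hta
          have h2 : Real.log t / (β / 4) < a ^ n := by
            rw [div_lt_iff₀ (by positivity)]; linarith
          show (Real.log t / (β / 4)) ^ n⁻¹ < a
          rwa [Real.rpow_inv_lt_iff_of_pos hL ha.le hn]
      _ ≤ _ := by
          rw [measure_Ioi_eq_ofReal_one_sub_cdf]
          apply ENNReal.ofReal_le_ofReal
          refine ht1.trans (le_of_eq ?_)
          rw [Real.rpow_inv_rpow hL hn.ne', Real.rpow_def_of_pos ht0]
          congr 1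
          field_simp
          ring
  rw [← Set.Ioc_union_Ioi_eq_Ioi (zero_le_one.trans hu1)]
  refine (lintegral_union_le _ _ _).trans_lt (ENNReal.add_lt_top.2 ⟨?_, ?_⟩)
  · calc ∫⁻ t in Set.Ioc 0 u, ν {a | t < Real.exp (β / 4 * a ^ n)}
        ≤ ∫⁻ t in Set.Ioc 0 u, 1 := lintegral_mono fun t => prob_le_one
      _ < ∞ := by simp
  · refine (setLIntegral_mono' measurableSet_Ioi key).trans_lt ?_
    exact (integrableOn_Ioi_rpow_of_lt (by norm_num : (-2 : ℝ) < -1)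
      (by linarith : 0 < u)).lintegral_lt_top

/-! ### Order statistics and almost sure absence of ties -/

theorem orderStat_le_iff {N k : ℕ} (y : Fin N → ℝ) (h1 : 1 ≤ k) (hk : k ≤ N) (c : ℝ) :
    orderStat y k ≤ c ↔ k ≤ (Finset.univ.filter fun i => y i ≤ c).card := by
  have hk' : k - 1 < N := by omega
  rw [orderStat, dif_pos hk']
  have hs := Tuple.lt_card_le_iff_apply_le_of_monotone (j := ⟨k - 1, hk'⟩) (a := c)
    (Tuple.monotone_sort y)
  have hc : (Finset.univ.filter fun i => (y ∘ Tuple.sort y) i ≤ c).card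
      = (Finset.univ.filter fun i => y i ≤ c).card :=
    Finset.card_equiv (Tuple.sort y) (by simp)
  rw [hc] at hs
  rw [Function.comp_apply] at hs
  rw [← hs]
  show k - 1 < _ ↔ _
  omega

theorem measurable_card_filter_le {N : ℕ} {δ : Type*} [MeasurableSpace δ] (f : δ → Fin N → ℝ)
    (hf : Measurable f) (c : ℝ) :
    Measurable fun y => (Finset.univ.filter fun i => f y i ≤ c).card := by
  simp only [Finset.card_filter]
  refine Finset.measurable_sum _ fun i _ => Measurable.ite ?_ measurable_const measurable_const
  exact measurableSet_le (by fun_prop) measurable_const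

theorem measurable_orderStat {N k : ℕ} (h1 : 1 ≤ k) (hk : k ≤ N) :
    Measurable fun y : Fin N → ℝ => orderStat y k := by
  refine measurable_of_Iic fun c => ?_
  have : (fun y : Fin N → ℝ => orderStat y k) ⁻¹' Set.Iic c
      = {y | k ≤ (Finset.univ.filter fun i => y i ≤ c).card} := by
    ext y
    exact orderStat_le_iff y h1 hk c
  rw [this]
  exact measurableSet_le measurable_const (measurable_card_filter_le _ measurable_id c)

theorem le_orderStat_self {N : ℕ} (y : Fin N → ℝ) (i : Fin N) : y i ≤ orderStat y N := by
  have hN : 1 ≤ N := by have := i.2; omega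
  have h := (orderStat_le_iff y hN le_rfl (orderStat y N)).1 le_rfl
  have hu : (Finset.univ.filter fun i => y i ≤ orderStat y N) = Finset.univ := by
    apply Finset.eq_univ_of_card
    rw [Fintype.card_fin]
    exact le_antisymm ((Finset.card_le_univ _).trans (by simp)) h
  have hi := Finset.mem_univ i
  rw [← hu] at hi
  exact (Finset.mem_filter.1 hi).2

theorem card_filter_le_orderStat_le {N k : ℕ} (y : Fin N → ℝ) (hy : Function.Injective y)
    (h1 : 1 ≤ k) (hk : k ≤ N) :
    (Finset.univ.filter fun i => y i ≤ orderStat y k).card ≤ k := by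
  have hk' : k - 1 < N := by omega
  have hsm : StrictMono (y ∘ Tuple.sort y) :=
    (Tuple.monotone_sort y).strictMono_of_injective (hy.comp (Tuple.sort y).injective)
  have hsub : (Finset.univ.filter fun i => y i ≤ orderStat y k)
      ⊆ (Finset.Iic (⟨k - 1, hk'⟩ : Fin N)).map (Tuple.sort y).toEmbedding := by
    intro i hi
    rw [Finset.mem_filter, orderStat, dif_pos hk'] at hi
    rw [Finset.mem_map_equiv, Finset.mem_Iic, ← hsm.le_iff_le]
    simpa using hi.2
  refine (Finset.card_le_card hsub).trans ?_
  rw [Finset.card_map, Fin.card_Iic]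
  show k - 1 + 1 ≤ k
  omega

section Model

variable {Ω : Type*} [MeasurableSpace Ω] {μ : Measure Ω} {h g : ℕ → Ω → ℝ}

/-- Two independent variables, one of which has no atoms, almost surely differ. -/
theorem ae_ne_of_indepFun [IsProbabilityMeasure μ] {X Y : Ω → ℝ} (hX : Measurable X)
    (hY : Measurable Y)
    (hXY : IndepFun X Y μ) (hat : ∀ x, μ.map Y {x} = 0) : ∀ᵐ ω ∂μ, X ω ≠ Y ω := by
  have := Measure.isProbabilityMeasure_map (μ := μ) hY.aemeasurable
  have hd : MeasurableSet {p : ℝ × ℝ | p.1 = p.2} :=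
    measurableSet_eq_fun measurable_fst measurable_snd
  have h0 : (μ.map fun ω => (X ω, Y ω)) {p : ℝ × ℝ | p.1 = p.2} = 0 := by
    rw [(indepFun_iff_map_prod_eq_prod_map_map hX.aemeasurable hY.aemeasurable).1 hXY,
      Measure.measure_prod_null hd]
    refine ae_of_all _ fun x => ?_
    have : Prod.mk x ⁻¹' {p : ℝ × ℝ | p.1 = p.2} = {x} := by
      ext y; simp [eq_comm]
    show μ.map Y (Prod.mk x ⁻¹' {p : ℝ × ℝ | p.1 = p.2}) = 0
    rw [this]
    exact hat x
  rw [Measure.map_apply (hX.prodMk hY) hd] at h0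
  rw [ae_iff]
  simpa using h0

theorem measurable_gains {N : ℕ} {f : ℕ → Ω → ℝ} (hf : ∀ i, Measurable (f i)) :
    Measurable (gains N f) := measurable_pi_lambda _ fun i => hf i

theorem ae_injective_gains [IsProbabilityMeasure μ] (hm : IsFadingModel μ h g)
    (hat : ∀ x, μ.map (g 0) {x} = 0) (N : ℕ) :
    ∀ᵐ ω ∂μ, Function.Injective (gains N g ω) := by
  have : ∀ i j : ℕ, i ≠ j → ∀ᵐ ω ∂μ, g i ω ≠ g j ω := fun i j hij =>
    ae_ne_of_indepFun (hm.measurable_g i) (hm.measurable_g j) (hm.iIndepFun_g.indepFun hij)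
      fun x => (hm.identDistrib_g j).map_eq ▸ hat x
  have h2 : ∀ᵐ ω ∂μ, ∀ i j : ℕ, i ≠ j → g i ω ≠ g j ω := by
    simp only [ae_all_iff]
    exact fun i j hij => by simpa [hij] using this i j hij
  filter_upwards [h2] with ω hω i j hij
  by_contra hne
  exact hω i j (fun e => hne (Fin.ext e)) hij

theorem indepFun_gains (hm : IsFadingModel μ h g) (N : ℕ) :
    IndepFun (gains N h) (gains N g) μ :=
  IndepFun.comp (φ := fun (x : ℕ → ℝ) (i : Fin N) => x i)
    (ψ := fun (x : ℕ → ℝ) (i : Fin N) => x i) hm.indepFun (by fun_prop) (by fun_prop)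

end Model

/-! ### The upper bound -/

/-- A deterministic bound on the rate when only the users in `A` transmit.  With `M` the largest
gain over `A`, it splits `log (1 + M ∑ q)` into `log (1 + M) + ∑ q` and bounds `s Mⁿ` by
`log k + (∑ exp (s xᵢⁿ)) / k`. -/
theorem log_one_add_sum_mul_le {ι : Type*} [Fintype ι] {s n : ℝ} (hs : 0 < s) (hn : 0 < n)
    {k : ℕ} (hk : 1 ≤ k) (x q : ι → ℝ) (hx : ∀ i, 0 < x i) (hq : ∀ i, 0 ≤ q i)
    (A : Finset ι) (hA : ∀ i, i ∉ A → q i = 0) :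
    Real.log (1 + ∑ i, x i * q i) ≤ ∑ i, q i +
      (Real.log 2 + 1 / n * (1 + 1 / s) + 1 / n * Real.log (1 + Real.log k)) +
      1 / (n * s * k) * ∑ i ∈ A, Real.exp (s * x i ^ n) := by
  set W := ∑ i ∈ A, Real.exp (s * x i ^ n) with hW
  have hk0 : (0 : ℝ) < k := by exact_mod_cast hk
  have hL : 0 ≤ Real.log k := Real.log_nonneg (by exact_mod_cast hk)
  have hW0 : 0 ≤ W := Finset.sum_nonneg fun i _ => (Real.exp_pos _).le
  set a := 1 / s * (Real.log k + W / k) with ha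
  have ha0 : 0 ≤ a := by positivity
  set M := (1 + a) ^ (1 / n) with hM
  have hM1 : 1 ≤ M := Real.one_le_rpow (by linarith) (by positivity)
  have hxM : ∀ i ∈ A, x i ≤ M := by
    intro i hi
    have h1 : Real.exp (s * x i ^ n) ≤ W :=
      Finset.single_le_sum (f := fun i => Real.exp (s * x i ^ n))
        (fun i _ => (Real.exp_pos _).le) hi
    have h2 : s * x i ^ n ≤ Real.log k + W / k := by
      -- `1 + u ≤ exp u` with `u = s xᵢⁿ - log k`; this `k` compensates the `k` terms of `W`.
      have h3 := Real.add_one_le_exp (s * x i ^ n - Real.log k)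
      rw [Real.exp_sub, Real.exp_log hk0] at h3
      have h4 : Real.exp (s * x i ^ n) / k ≤ W / k := by gcongr
      linarith
    have h5 : x i ^ n ≤ 1 + a := by
      have : x i ^ n ≤ a := by
        rw [ha, one_div, inv_mul_eq_div, le_div_iff₀ hs]
        linarith
      linarith
    rw [hM, one_div]
    rwa [Real.le_rpow_inv_iff_of_pos (hx i).le (by linarith) hn]
  set S := ∑ i, q i with hS
  have hS0 : 0 ≤ S := Finset.sum_nonneg fun i _ => hq i
  have hsum0 : 0 ≤ ∑ i, x i * q i := Finset.sum_nonneg fun i _ => mul_nonneg (hx i).le (hq i)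
  have hsum : ∑ i, x i * q i ≤ M * S := by
    rw [hS, Finset.mul_sum]
    refine Finset.sum_le_sum fun i _ => ?_
    by_cases hi : i ∈ A
    · exact mul_le_mul_of_nonneg_right (hxM i hi) (hq i)
    · simp [hA i hi]
  have e1 : Real.log (1 + ∑ i, x i * q i) ≤ Real.log (2 * M * (1 + S)) := by
    apply Real.log_le_log (by linarith)
    nlinarith
  have e2 : Real.log (2 * M * (1 + S)) = Real.log 2 + 1 / n * Real.log (1 + a)
      + Real.log (1 + S) := by
    rw [Real.log_mul (by positivity) (by positivity), Real.log_mul (by positivity) (by positivity),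
      hM, Real.log_rpow (by linarith)]
  have e3 : Real.log (1 + S) ≤ S := by
    have := Real.log_le_sub_one_of_pos (show 0 < 1 + S by linarith)
    linarith
  have e4 : Real.log (1 + a) ≤ Real.log (1 + Real.log k) + (1 + 1 / s + W / (s * k)) := by
    have hp : 0 < 1 + Real.log k := by linarith
    -- The tangent of `log` at `1 + log k` makes the bound linear in `W`, ready for the expectation.
    have h6 := Real.log_le_sub_one_of_pos (show 0 < (1 + a) / (1 + Real.log k) by positivity)
    rw [Real.log_div (by positivity) hp.ne'] at h6
    have h7 : (1 + a) / (1 + Real.log k) ≤ 1 + 1 / s + W / (s * k) := by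
      rw [div_le_iff₀ hp, ha]
      have : W / (s * k) = 1 / s * (W / k) := by field_simp
      rw [this]
      have h8 : 0 ≤ 1 / s * (W / k) * Real.log k := by positivity
      have h9 : 0 ≤ 1 / s := by positivity
      nlinarith
    linarith
  have e5 := mul_le_mul_of_nonneg_left e4 (show 0 ≤ 1 / n by positivity)
  have e6 : 1 / (n * s * k) * W = 1 / n * (W / (s * k)) := by field_simp
  rw [e6]
  linarith

section Model

variable {Ω : Type*} [MeasurableSpace Ω] {μ : Measure Ω} {h g : ℕ → Ω → ℝ}

open Classical in
/-- Which users may transmit depends on `g` only, and almost surely exactly `k` of them may, so the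
sum of `φ (h i)` over these users has the same mean as a sum over `k` fixed users. -/
theorem lintegral_sum_feedback_le [IsProbabilityMeasure μ] (hm : IsFadingModel μ h g)
    (hat : ∀ x, μ.map (g 0) {x} = 0)
    {φ : ℝ → ℝ≥0∞} (hφ : Measurable φ) {N k : ℕ} (h1 : 1 ≤ k) (hk : k ≤ N) :
    ∫⁻ ω, ∑ i : Fin N, (if gains N g ω i ≤ orderStat (gains N g ω) k then 1 else 0)
      * φ (gains N h ω i) ∂μ ≤ k * ∫⁻ x, φ x ∂(μ.map (h 0)) := by
  have hgm := measurable_gains (N := N) hm.measurable_g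
  have hhm := measurable_gains (N := N) hm.measurable_h
  have hI : ∀ i : Fin N, Measurable fun y : Fin N → ℝ =>
      if y i ≤ orderStat y k then (1 : ℝ≥0∞) else 0 := fun i =>
    Measurable.ite (measurableSet_le (by fun_prop) (measurable_orderStat h1 hk))
      measurable_const measurable_const
  have hφi : ∀ i : Fin N, Measurable fun x : Fin N → ℝ => φ (x i) := fun i => by fun_prop
  have hmean : ∀ i : Fin N, ∫⁻ ω, φ (gains N h ω i) ∂μ = ∫⁻ x, φ x ∂(μ.map (h 0)) := fun i => by
    rw [← (hm.identDistrib_h i).map_eq, lintegral_map hφ (hm.measurable_h i)]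
    rfl
  have hprod : ∀ i : Fin N, Measurable fun ω =>
      (if gains N g ω i ≤ orderStat (gains N g ω) k then 1 else 0) * φ (gains N h ω i) :=
    fun i => ((hI i).comp hgm).mul ((hφi i).comp hhm)
  have hIg : ∀ i : Fin N, Measurable fun ω =>
      (if gains N g ω i ≤ orderStat (gains N g ω) k then (1 : ℝ≥0∞) else 0) :=
    fun i => (hI i).comp hgm
  rw [lintegral_finsetSum _ fun i _ => hprod i]
  have hi : ∀ i : Fin N, ∫⁻ ω, (if gains N g ω i ≤ orderStat (gains N g ω) k then 1 else 0)
      * φ (gains N h ω i) ∂μ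
      = (∫⁻ ω, (if gains N g ω i ≤ orderStat (gains N g ω) k then 1 else 0) ∂μ)
        * ∫⁻ x, φ x ∂(μ.map (h 0)) := fun i => by
    rw [← hmean i]
    exact lintegral_mul_eq_lintegral_mul_lintegral_of_indepFun ((hI i).comp hgm)
      ((hφi i).comp hhm) ((indepFun_gains hm N).symm.comp (hI i) (hφi i))
  rw [Finset.sum_congr rfl fun i _ => hi i, ← Finset.sum_mul,
    ← lintegral_finsetSum _ fun i _ => hIg i]
  gcongr
  calc _ ≤ ∫⁻ _ω, (k : ℝ≥0∞) ∂μ := by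
        apply lintegral_mono_ae
        filter_upwards [ae_injective_gains hm hat N] with ω hω
        rw [← Finset.natCast_card_filter]
        exact_mod_cast card_filter_le_orderStat_le _ hω h1 hk
    _ = k := by simp

theorem ae_gains_pos (hm : IsFadingModel μ h g) (hpos : ∀ᵐ x ∂(μ.map (h 0)), 0 < x) (N : ℕ) :
    ∀ᵐ ω ∂μ, ∀ i, 0 < gains N h ω i := by
  rw [ae_all_iff]
  intro i
  rw [← (hm.identDistrib_h i).map_eq] at hpos
  exact ae_of_ae_map (hm.measurable_h i).aemeasurable hpos

/-- The upper bound `(1 / n) log (1 + log k) + O(1)`, uniform in the number of users. -/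
theorem exists_rateSCG_le [IsProbabilityMeasure μ] (hm : IsFadingModel μ h g)
    {αh βh nh lh : ℝ} {Hh : ℝ → ℝ} {ηh γh : ℝ}
    (hh : IsClassC (cdf (μ.map (h 0))) αh βh nh lh Hh ηh γh)
    (hat : ∀ x, μ.map (g 0) {x} = 0) {Pave Qave : ℝ} (hP : 0 ≤ Pave) :
    ∃ D : ℝ, ∀ N k : ℕ, 1 ≤ k → k ≤ N → rateSCG μ h g Pave Qave N k
      ≤ ENNReal.ofReal (D + 1 / nh * Real.log (1 + Real.log k)) := by
  classical
  have := Measure.isProbabilityMeasure_map (μ := μ) (hm.measurable_h 0).aemeasurable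
  have hn := hh.n_pos
  set s := βh / 4 with hs
  have hs0 : 0 < s := by have := hh.β_pos; positivity
  set φ : ℝ → ℝ≥0∞ := fun x => ENNReal.ofReal (Real.exp (s * x ^ nh)) with hφ
  have hφm : Measurable φ := by fun_prop
  set C := ∫⁻ x, φ x ∂(μ.map (h 0)) with hC
  have hCt : C ≠ ∞ := hh.lintegral_exp_lt_top.ne
  set D := Real.log 2 + 1 / nh * (1 + 1 / s) with hD
  have hD0 : 0 ≤ D := by
    have := Real.log_nonneg (show (1 : ℝ) ≤ 2 by norm_num)
    positivity
  refine ⟨Pave + D + 1 / (nh * s) * C.toReal, fun N k h1 hk => ?_⟩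
  have hk0 : (0 : ℝ) < k := by exact_mod_cast h1
  have hlog : 0 ≤ Real.log k := Real.log_nonneg (by exact_mod_cast h1)
  have hloglog : 0 ≤ Real.log (1 + Real.log k) := Real.log_nonneg (by linarith)
  have hgm := measurable_gains (N := N) hm.measurable_g
  have hhm := measurable_gains (N := N) hm.measurable_h
  refine iSup₂_le fun P ⟨hF, hfb⟩ => ?_
  have hPm := hF.measurable
  have hS : Measurable fun ω => ENNReal.ofReal (∑ i, P (gains N h ω, gains N g ω) i) :=
    (Finset.measurable_sum _ fun i _ =>
      (measurable_pi_apply i).comp (hPm.comp (hhm.prodMk hgm))).ennreal_ofReal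
  have hSL : Measurable fun ω => ENNReal.ofReal (∑ i, P (gains N h ω, gains N g ω) i)
      + ENNReal.ofReal (D + 1 / nh * Real.log (1 + Real.log k)) := hS.add measurable_const
  set L := D + 1 / nh * Real.log (1 + Real.log k) with hL
  have hL0 : 0 ≤ L := by positivity
  calc ergodicRate μ h g N P
      ≤ ∫⁻ ω, (ENNReal.ofReal (∑ i, P (gains N h ω, gains N g ω) i) + ENNReal.ofReal L
          + ENNReal.ofReal (1 / (nh * s * k)) *
            ∑ i : Fin N, (if gains N g ω i ≤ orderStat (gains N g ω) k then 1 else 0)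
              * φ (gains N h ω i)) ∂μ := by
        apply lintegral_mono_ae
        filter_upwards [ae_gains_pos hm hh.ae_pos N] with ω hω
        have hS0 : 0 ≤ ∑ i, P (gains N h ω, gains N g ω) i :=
          Finset.sum_nonneg fun i _ => hF.nonneg _ i
        have key := log_one_add_sum_mul_le hs0 hn h1 (gains N h ω)
          (P (gains N h ω, gains N g ω)) hω (hF.nonneg _)
          (Finset.univ.filter fun i => gains N g ω i ≤ orderStat (gains N g ω) k)
          (fun i hi => hfb _ _ i (by simpa using hi))
        refine (ENNReal.ofReal_le_ofReal key).trans (le_of_eq ?_)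
        rw [ENNReal.ofReal_add (by positivity) (by positivity), ENNReal.ofReal_add hS0 hL0,
          ENNReal.ofReal_mul (by positivity),
          ENNReal.ofReal_sum_of_nonneg fun i _ => (Real.exp_pos _).le, Finset.sum_filter]
        simp only [ite_mul, one_mul, zero_mul, hφ]
    _ ≤ ENNReal.ofReal Pave + ENNReal.ofReal L + ENNReal.ofReal (1 / (nh * s * k)) * (k * C) := by
        rw [lintegral_add_left hSL, lintegral_add_left hS,
          lintegral_const_mul' _ _ ENNReal.ofReal_ne_top]
        gcongr
        · exact hF.power
        · simp
        · exact lintegral_sum_feedback_le hm hat hφm h1 hk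
    _ = _ := by
        rw [← ENNReal.ofReal_toReal hCt, ← ENNReal.ofReal_natCast k,
          ← ENNReal.ofReal_mul hk0.le, ← ENNReal.ofReal_mul (by positivity),
          ← ENNReal.ofReal_add hP hL0, ← ENNReal.ofReal_add (by positivity) (by positivity),
          ENNReal.toReal_ofReal ENNReal.toReal_nonneg]
        congr 1
        rw [hL]
        field_simp
        ring

theorem rateSCG_le_rateFull (μ : Measure Ω) (h g : ℕ → Ω → ℝ) (Pave Qave : ℝ) (N k : ℕ) :
    rateSCG μ h g Pave Qave N k ≤ rateFull μ h g Pave Qave N :=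
  iSup_mono fun _ => iSup_mono' fun hP => ⟨hP.1, le_rfl⟩

/-- The feedback constraint with `k = N` is void. -/
theorem rateFull_eq_rateSCG_self (μ : Measure Ω) (h g : ℕ → Ω → ℝ) (Pave Qave : ℝ) (N : ℕ) :
    rateFull μ h g Pave Qave N = rateSCG μ h g Pave Qave N N := by
  refine le_antisymm (iSup₂_le fun P hP => ?_) (rateSCG_le_rateFull _ _ _ _ _ _ _)
  exact le_iSup₂_of_le P ⟨hP, fun x y i hi => absurd (le_orderStat_self y i) hi.not_ge⟩ le_rfl

theorem rateFull_ne_top [IsProbabilityMeasure μ] (hm : IsFadingModel μ h g)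
    {αh βh nh lh : ℝ} {Hh : ℝ → ℝ} {ηh γh : ℝ}
    (hh : IsClassC (cdf (μ.map (h 0))) αh βh nh lh Hh ηh γh)
    (hat : ∀ x, μ.map (g 0) {x} = 0) {Pave Qave : ℝ} (hP : 0 ≤ Pave) (N : ℕ) :
    rateFull μ h g Pave Qave N ≠ ∞ := by
  rcases Nat.eq_zero_or_pos N with rfl | hN
  · simp [rateFull, ergodicRate]
  · obtain ⟨D, hD⟩ := exists_rateSCG_le hm hh hat (Qave := Qave) hP
    rw [rateFull_eq_rateSCG_self]
    exact ((hD N N hN le_rfl).trans_lt ENNReal.ofReal_lt_top).ne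

end Model

/-! ### The lower bound: a threshold policy -/

section Model

variable {Ω : Type*} [MeasurableSpace Ω] {μ : Measure Ω} {h g : ℕ → Ω → ℝ}

open Classical in
/-- The users that report under `k`-smallest-channel-gains feedback, interfere with gain at most
`1`, and have gain above the threshold `t` towards the secondary base station. -/
noncomputable def activeUsers {N : ℕ} (t : ℝ) (k : ℕ) (z : (Fin N → ℝ) × (Fin N → ℝ)) :
    Finset (Fin N) :=
  Finset.univ.filter fun i => z.2 i ≤ orderStat z.2 k ∧ z.2 i ≤ 1 ∧ t < z.1 i

open Classical in
/-- The policy that shares the total power `p` equally among the active users. -/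
noncomputable def thresholdPolicy (N : ℕ) (p t : ℝ) (k : ℕ) : Policy N :=
  fun z i => if i ∈ activeUsers t k z then p / (activeUsers t k z).card else 0

theorem mem_activeUsers {N k : ℕ} {t : ℝ} {z : (Fin N → ℝ) × (Fin N → ℝ)} {i : Fin N} :
    i ∈ activeUsers t k z ↔ z.2 i ≤ orderStat z.2 k ∧ z.2 i ≤ 1 ∧ t < z.1 i := by
  simp [activeUsers]

theorem measurableSet_mem_activeUsers {N k : ℕ} (h1 : 1 ≤ k) (hk : k ≤ N) (t : ℝ) (i : Fin N) :
    MeasurableSet {z : (Fin N → ℝ) × (Fin N → ℝ) | i ∈ activeUsers t k z} := by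
  simp only [mem_activeUsers]
  have hm : Measurable fun z : (Fin N → ℝ) × (Fin N → ℝ) => orderStat z.2 k :=
    (measurable_orderStat h1 hk).comp measurable_snd
  have h2 : Measurable fun z : (Fin N → ℝ) × (Fin N → ℝ) => z.2 i := by fun_prop
  have h3 : Measurable fun z : (Fin N → ℝ) × (Fin N → ℝ) => z.1 i := by fun_prop
  exact (measurableSet_le h2 hm).inter ((measurableSet_le h2 measurable_const).inter
    (measurableSet_lt measurable_const h3))

theorem measurable_thresholdPolicy {N k : ℕ} (h1 : 1 ≤ k) (hk : k ≤ N) (p t : ℝ) :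
    Measurable (thresholdPolicy N p t k) := by
  classical
  have hc : Measurable fun z : (Fin N → ℝ) × (Fin N → ℝ) => ((activeUsers t k z).card : ℝ) := by
    have : ∀ z : (Fin N → ℝ) × (Fin N → ℝ), ((activeUsers t k z).card : ℝ)
        = ∑ i, if i ∈ activeUsers t k z then 1 else 0 := fun z => by simp
    simp only [this]
    exact Finset.measurable_sum _ fun i _ =>
      Measurable.ite (measurableSet_mem_activeUsers h1 hk t i) measurable_const measurable_const
  refine measurable_pi_lambda _ fun i => ?_
  unfold thresholdPolicy
  exact Measurable.ite (measurableSet_mem_activeUsers h1 hk t i) (measurable_const.div hc)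
    measurable_const

theorem thresholdPolicy_nonneg {N k : ℕ} {p t : ℝ} (hp : 0 ≤ p)
    (z : (Fin N → ℝ) × (Fin N → ℝ)) (i : Fin N) : 0 ≤ thresholdPolicy N p t k z i := by
  unfold thresholdPolicy
  split_ifs <;> positivity

theorem sum_thresholdPolicy {N k : ℕ} {p t : ℝ} {z : (Fin N → ℝ) × (Fin N → ℝ)}
    (hz : (activeUsers t k z).Nonempty) : ∑ i, thresholdPolicy N p t k z i = p := by
  have : ((activeUsers t k z).card : ℝ) ≠ 0 := by exact_mod_cast hz.card_pos.ne'
  simp only [thresholdPolicy, Finset.sum_ite_mem, Finset.univ_inter, Finset.sum_const,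
    nsmul_eq_mul]
  field_simp

theorem sum_thresholdPolicy_le {N k : ℕ} {p t : ℝ} (hp : 0 ≤ p)
    (z : (Fin N → ℝ) × (Fin N → ℝ)) : ∑ i, thresholdPolicy N p t k z i ≤ p := by
  rcases (activeUsers t k z).eq_empty_or_nonempty with hz | hz
  · simpa [thresholdPolicy, hz] using hp
  · exact (sum_thresholdPolicy hz).le

theorem isFeasible_thresholdPolicy [IsProbabilityMeasure μ] {N k : ℕ} (h1 : 1 ≤ k) (hk : k ≤ N)
    {p t Pave Qave : ℝ} (hp : 0 ≤ p) (hP : p ≤ Pave) (hQ : p ≤ Qave) :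
    IsFeasible μ h g Pave Qave N (thresholdPolicy N p t k) where
  measurable := measurable_thresholdPolicy h1 hk p t
  nonneg := thresholdPolicy_nonneg hp
  power := by
    calc _ ≤ ∫⁻ _ω, ENNReal.ofReal Pave ∂μ := by
          refine lintegral_mono fun ω => ENNReal.ofReal_le_ofReal ?_
          exact (sum_thresholdPolicy_le hp _).trans hP
      _ = _ := by simp
  interference := by
    calc _ ≤ ∫⁻ _ω, ENNReal.ofReal Qave ∂μ := by
          refine lintegral_mono fun ω => ENNReal.ofReal_le_ofReal ?_
          refine le_trans (Finset.sum_le_sum fun i _ => ?_)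
            ((sum_thresholdPolicy_le (k := k) (t := t) hp (gains N h ω, gains N g ω)).trans hQ)
          by_cases hi : i ∈ activeUsers t k (gains N h ω, gains N g ω)
          · exact mul_le_of_le_one_left (thresholdPolicy_nonneg hp _ i) (mem_activeUsers.1 hi).2.1
          · simp [thresholdPolicy, hi]
      _ = _ := by simp

theorem satisfiesFeedback_thresholdPolicy (N k : ℕ) (p t : ℝ) :
    SatisfiesFeedback N k (thresholdPolicy N p t k) := by
  intro x y i hi
  have : i ∉ activeUsers t k (x, y) := fun hm => hi.not_ge (mem_activeUsers.1 hm).1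
  simp [thresholdPolicy, this]

/-- The rate of the threshold policy is at least `log (1 + p t)` whenever somebody is active. -/
theorem le_rateSCG [IsProbabilityMeasure μ] (hm : IsFadingModel μ h g) {N k : ℕ} (h1 : 1 ≤ k)
    (hk : k ≤ N) {p t Pave Qave : ℝ} (hp : 0 ≤ p) (hP : p ≤ Pave) (hQ : p ≤ Qave) (ht : 0 ≤ t) :
    ENNReal.ofReal (Real.log (1 + p * t)) *
      μ {ω | (activeUsers t k (gains N h ω, gains N g ω)).Nonempty}
      ≤ rateSCG μ h g Pave Qave N k := by
  refine le_iSup₂_of_le (thresholdPolicy N p t k) ⟨isFeasible_thresholdPolicy h1 hk hp hP hQ,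
    satisfiesFeedback_thresholdPolicy N k p t⟩ ?_
  have hmeas : MeasurableSet {ω | (activeUsers t k (gains N h ω, gains N g ω)).Nonempty} := by
    simp only [Finset.Nonempty, Set.ofPred_exists]
    exact MeasurableSet.iUnion fun i => (measurableSet_mem_activeUsers h1 hk t i).preimage
      ((measurable_gains hm.measurable_h).prodMk (measurable_gains hm.measurable_g))
  rw [← lintegral_indicator_const hmeas]
  refine lintegral_mono fun ω => ?_
  by_cases hω : ω ∈ {ω | (activeUsers t k (gains N h ω, gains N g ω)).Nonempty}
  swap
  · rw [Set.indicator_of_notMem hω]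
    exact zero_le
  rw [Set.indicator_of_mem hω]
  apply ENNReal.ofReal_le_ofReal
  apply Real.log_le_log (by positivity)
  have hs := sum_thresholdPolicy (p := p) (show (activeUsers t k _).Nonempty from hω)
  have : p * t ≤ ∑ i, gains N h ω i *
      thresholdPolicy N p t k (gains N h ω, gains N g ω) i := by
    nth_rewrite 1 [← hs]
    rw [mul_comm, Finset.mul_sum]
    refine Finset.sum_le_sum fun i _ => ?_
    by_cases hi : i ∈ activeUsers t k (gains N h ω, gains N g ω)
    · exact mul_le_mul_of_nonneg_right (mem_activeUsers.1 hi).2.2.le (thresholdPolicy_nonneg hp _ i)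
    · simp [thresholdPolicy, hi]
  linarith

open Classical in
/-- All reporting users have gain at most `t` with probability at most `F(t) ^ k`: conditionally on
`g`, these are at least `k` independent events of probability `F(t)`. -/
theorem measure_forall_le_le [IsProbabilityMeasure μ] (hm : IsFadingModel μ h g) {N k : ℕ}
    (h1 : 1 ≤ k) (hk : k ≤ N) (t : ℝ) :
    μ {ω | ∀ i, gains N g ω i ≤ orderStat (gains N g ω) k → gains N h ω i ≤ t}
      ≤ μ.map (h 0) (Set.Iic t) ^ k := by
  have hprob := Measure.isProbabilityMeasure_map (μ := μ) (hm.measurable_h 0).aemeasurable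
  set A : (Fin N → ℝ) → Finset (Fin N) :=
    fun y => Finset.univ.filter fun i => y i ≤ orderStat y k with hA
  have hAm : ∀ S, MeasurableSet (A ⁻¹' {S}) := by
    intro S
    have : A ⁻¹' {S} = ⋂ i, {y | y i ≤ orderStat y k ↔ i ∈ S} := by
      ext y
      simp [hA, Finset.ext_iff]
    rw [this]
    refine MeasurableSet.iInter fun i => ?_
    have hle : MeasurableSet {y : Fin N → ℝ | y i ≤ orderStat y k} :=
      measurableSet_le (by fun_prop) (measurable_orderStat h1 hk)
    by_cases hi : i ∈ S
    · simpa [hi] using hle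
    · have : {y : Fin N → ℝ | y i ≤ orderStat y k ↔ i ∈ S} = {y | y i ≤ orderStat y k}ᶜ := by
        ext y
        simp [hi]
      rw [this]
      exact hle.compl
  have hgm := measurable_gains (N := N) hm.measurable_g
  have hBm : ∀ S : Finset (Fin N), MeasurableSet {x : Fin N → ℝ | ∀ i ∈ S, x i ≤ t} := by
    intro S
    simp only [Set.ofPred_forall]
    exact MeasurableSet.iInter fun i => MeasurableSet.iInter fun _ =>
      measurableSet_le (by fun_prop) measurable_const
  have hB : ∀ S : Finset (Fin N), μ (gains N h ⁻¹' {x | ∀ i ∈ S, x i ≤ t})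
      = μ.map (h 0) (Set.Iic t) ^ S.card := by
    intro S
    have hind : iIndepFun (fun i : Fin N => h i) μ :=
      hm.iIndepFun_h.precomp Fin.val_injective
    have := hind.measure_inter_preimage_eq_mul S (sets := fun _ => Set.Iic t)
      fun _ _ => measurableSet_Iic
    have he : gains N h ⁻¹' {x | ∀ i ∈ S, x i ≤ t} = ⋂ i ∈ S, h i ⁻¹' Set.Iic t := by
      ext ω
      simp [gains]
    rw [he, this]
    refine Finset.prod_eq_pow_card fun i _ => ?_
    rw [← (hm.identDistrib_h i).map_eq, Measure.map_apply (hm.measurable_h i) measurableSet_Iic]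
  calc _ ≤ μ (⋃ S ∈ (Finset.univ : Finset (Finset (Fin N))),
            (gains N h ⁻¹' {x | ∀ i ∈ S, x i ≤ t} ∩ gains N g ⁻¹' (A ⁻¹' {S}))) := by
        refine measure_mono fun ω hω => ?_
        simp only [Set.mem_iUnion]
        exact ⟨A (gains N g ω), Finset.mem_univ _,
          fun i hi => hω i (Finset.mem_filter.1 hi).2, rfl⟩
    _ ≤ ∑ S, μ (gains N h ⁻¹' {x | ∀ i ∈ S, x i ≤ t} ∩ gains N g ⁻¹' (A ⁻¹' {S})) :=
        measure_biUnion_finset_le _ _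
    _ ≤ ∑ S, μ.map (h 0) (Set.Iic t) ^ k * μ ((A ∘ gains N g) ⁻¹' {S}) := by
        refine Finset.sum_le_sum fun S _ => ?_
        rw [(indepFun_gains hm N).measure_inter_preimage_eq_mul _ _ (hBm S) (hAm S), hB S]
        rcases lt_or_ge S.card k with hS | hS
        · have : A ⁻¹' {S} = ∅ := by
            rw [Set.eq_empty_iff_forall_notMem]
            rintro y rfl
            exact hS.not_ge ((orderStat_le_iff y h1 hk _).1 le_rfl)
          simp [this]
        · exact mul_le_mul' (pow_le_pow_right_of_le_one' prob_le_one hS) le_rfl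
    _ = _ := by
        rw [← Finset.mul_sum, sum_measure_preimage_singleton (f := A ∘ gains N g) Finset.univ
          fun S _ => (hAm S).preimage hgm]
        simp

/-- Nobody is active with probability at most `P(#{i : gᵢ ≤ 1} < k) + F(t) ^ k`. -/
theorem one_sub_le_measure_activeUsers [IsProbabilityMeasure μ] (hm : IsFadingModel μ h g)
    {N k : ℕ} (h1 : 1 ≤ k) (hk : k ≤ N) (t : ℝ) :
    1 - (μ {ω | (Finset.univ.filter fun i => gains N g ω i ≤ 1).card < k}
        + μ.map (h 0) (Set.Iic t) ^ k)
      ≤ μ {ω | (activeUsers t k (gains N h ω, gains N g ω)).Nonempty} := by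
  rw [tsub_le_iff_right, ← measure_univ (μ := μ)]
  set E := {ω | (activeUsers t k (gains N h ω, gains N g ω)).Nonempty} with hE
  set B := {ω | (Finset.univ.filter fun i => gains N g ω i ≤ 1).card < k} with hB
  set C := {ω | ∀ i, gains N g ω i ≤ orderStat (gains N g ω) k → gains N h ω i ≤ t} with hC
  have hcover : Set.univ ⊆ E ∪ (B ∪ C) := by
    intro ω _
    by_contra hω
    simp only [Set.mem_union, not_or] at hω
    obtain ⟨hωE, hωB, hωC⟩ := hω
    refine hωC fun i hi => ?_
    by_contra hlt
    refine hωE ⟨i, mem_activeUsers.2 ⟨hi, hi.trans ?_, not_le.1 hlt⟩⟩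
    exact (orderStat_le_iff _ h1 hk 1).2 (not_lt.1 hωB)
  refine (measure_mono hcover).trans ((measure_union_le _ _).trans ?_)
  gcongr
  refine (measure_union_le _ _).trans ?_
  gcongr
  exact measure_forall_le_le hm h1 hk t

/-- By the law of large numbers a positive fraction of the users have `gᵢ ≤ 1`. -/
theorem tendsto_measure_card_lt [IsProbabilityMeasure μ] (hm : IsFadingModel μ h g)
    (hq : 0 < μ.map (g 0) (Set.Iic 1)) {K : ℕ → ℕ}
    (hK : (fun N : ℕ => (K N : ℝ)) =o[atTop] (fun N : ℕ => (N : ℝ))) :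
    Tendsto (fun N : ℕ =>
      μ {ω | (Finset.univ.filter fun i => gains N g ω i ≤ 1).card < K N}) atTop (𝓝 0) := by
  set φ : ℝ → ℝ := (Set.Iic 1).indicator fun _ => 1 with hφ
  have hφm : Measurable φ := measurable_const.indicator measurableSet_Iic
  set X : ℕ → Ω → ℝ := fun i ω => φ (g i ω) with hX
  have hXm : ∀ i, Measurable (X i) := fun i => hφm.comp (hm.measurable_g i)
  have hX01 : ∀ ω, X 0 ω = (g 0 ⁻¹' Set.Iic 1).indicator 1 ω := fun ω => rfl
  have hint : Integrable (X 0) μ := by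
    have : X 0 = (g 0 ⁻¹' Set.Iic 1).indicator (fun _ => (1 : ℝ)) := rfl
    rw [this]
    exact (integrable_const 1).indicator (hm.measurable_g 0 measurableSet_Iic)
  have hq' : 0 < ∫ ω, X 0 ω ∂μ := by
    have : ∫ ω, X 0 ω ∂μ = μ.real (g 0 ⁻¹' Set.Iic 1) := by
      simp only [hX01]
      exact integral_indicator_one (hm.measurable_g 0 measurableSet_Iic)
    rw [this, measureReal_def, ← Measure.map_apply (hm.measurable_g 0) measurableSet_Iic]
    refine ENNReal.toReal_pos hq.ne' ?_
    rw [Measure.map_apply (hm.measurable_g 0) measurableSet_Iic]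
    exact measure_ne_top _ _
  set q := ∫ ω, X 0 ω ∂μ with hqdef
  have hslln := strong_law_ae_real X hint
    (fun i j hij => (hm.iIndepFun_g.indepFun hij).comp hφm hφm)
    (fun i => (hm.identDistrib_g i).comp hφm)
  have hmeas := tendstoInMeasure_of_tendsto_ae (f := fun n ω => (∑ i ∈ Finset.range n, X i ω) / n)
    (g := fun _ => q)
    (fun n => ((Finset.measurable_sum _ fun i _ => hXm i).div_const _).aestronglyMeasurable) hslln
  rw [tendstoInMeasure_iff_dist] at hmeas
  refine tendsto_of_tendsto_of_tendsto_of_le_of_le' tendsto_const_nhds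
    (hmeas (q / 2) (by positivity)) (Eventually.of_forall fun _ => zero_le) ?_
  filter_upwards [hK.bound (show 0 < q / 2 by positivity), eventually_gt_atTop 0] with N hN hN0
  have hN0' : (0 : ℝ) < N := by exact_mod_cast hN0
  rw [Real.norm_of_nonneg (by positivity), Real.norm_of_nonneg hN0'.le] at hN
  refine measure_mono fun ω hω => ?_
  have hcard : ((Finset.univ.filter fun i => gains N g ω i ≤ 1).card : ℝ)
      = ∑ i ∈ Finset.range N, X i ω := by
    rw [← Fin.sum_univ_eq_sum_range (fun i => X i ω), Finset.card_filter]
    push_cast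
    refine Finset.sum_congr rfl fun i _ => ?_
    simp only [hX, hφ, Set.indicator_apply, gains, Set.mem_Iic]
    congr
  have hlt : ((Finset.univ.filter fun i => gains N g ω i ≤ 1).card : ℝ) < K N := by
    exact_mod_cast hω
  rw [hcard] at hlt
  show q / 2 ≤ dist ((∑ i ∈ Finset.range N, X i ω) / N) q
  have h3 : (∑ i ∈ Finset.range N, X i ω) / N ≤ q / 2 := by
    rw [div_le_iff₀ hN0']; linarith
  rw [dist_comm, Real.dist_eq]
  exact le_trans (by linarith) (le_abs_self _)

end Model

/-! ### Asymptotics -/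

theorem tendsto_log_log_natCast_atTop :
    Tendsto (fun k : ℕ => Real.log (Real.log k)) atTop atTop :=
  Real.tendsto_log_atTop.comp (Real.tendsto_log_atTop.comp tendsto_natCast_atTop_atTop)

/-- The upper bound on the rate is asymptotic to `(1 / n) log log k`. -/
theorem tendsto_upper_div_log_log (D c : ℝ) :
    Tendsto (fun k : ℕ => (D + c * Real.log (1 + Real.log k)) / Real.log (Real.log k))
      atTop (𝓝 c) := by
  have hL : Tendsto (fun k : ℕ => Real.log k) atTop atTop :=
    Real.tendsto_log_atTop.comp tendsto_natCast_atTop_atTop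
  have h1 : Tendsto (fun k : ℕ => (D + c * Real.log (1 + 1 / Real.log k))
      / Real.log (Real.log k) + c) atTop (𝓝 c) := by
    have h2 : Tendsto (fun k : ℕ => Real.log (1 + 1 / Real.log k)) atTop (𝓝 0) := by
      have h3 : Tendsto (fun k : ℕ => 1 + 1 / Real.log k) atTop (𝓝 1) := by
        simpa using (hL.inv_tendsto_atTop).const_add 1
      simpa using h3.log one_ne_zero
    simpa using (((h2.const_mul c).const_add D).div_atTop
      tendsto_log_log_natCast_atTop).add_const c
  refine h1.congr' ?_
  filter_upwards [hL.eventually_gt_atTop 0,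
    tendsto_log_log_natCast_atTop.eventually_gt_atTop 0] with k hk hkk
  have : Real.log (1 + Real.log k) = Real.log (Real.log k) + Real.log (1 + 1 / Real.log k) := by
    rw [← Real.log_mul hk.ne' (by positivity)]
    congr 1
    field_simp
    ring
  rw [this]
  field_simp
  ring

/-- The lower bound on the rate, with threshold `t = (log k / b) ^ (1 / n)`, is asymptotic to
`(1 / n) log log k`. -/
theorem tendsto_lower_div_log_log {p b n : ℝ} (hp : 0 < p) (hb : 0 < b) (hn : 0 < n) :
    Tendsto (fun k : ℕ => Real.log (1 + p * (Real.log k / b) ^ n⁻¹) / Real.log (Real.log k))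
      atTop (𝓝 (1 / n)) := by
  have hL : Tendsto (fun k : ℕ => Real.log k) atTop atTop :=
    Real.tendsto_log_atTop.comp tendsto_natCast_atTop_atTop
  have ht : Tendsto (fun k : ℕ => p * (Real.log k / b) ^ n⁻¹) atTop atTop :=
    ((tendsto_rpow_atTop (inv_pos.2 hn)).comp (hL.atTop_div_const hb)).const_mul_atTop hp
  have h1 : Tendsto (fun k : ℕ => (Real.log p - n⁻¹ * Real.log b
      + Real.log (1 + 1 / (p * (Real.log k / b) ^ n⁻¹))) / Real.log (Real.log k) + n⁻¹)
      atTop (𝓝 (1 / n)) := by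
    have h2 : Tendsto (fun k : ℕ => Real.log (1 + 1 / (p * (Real.log k / b) ^ n⁻¹)))
        atTop (𝓝 0) := by
      have h3 : Tendsto (fun k : ℕ => 1 + 1 / (p * (Real.log k / b) ^ n⁻¹)) atTop (𝓝 1) := by
        simpa using (ht.inv_tendsto_atTop).const_add 1
      simpa using h3.log one_ne_zero
    simpa using ((h2.const_add (Real.log p - n⁻¹ * Real.log b)).div_atTop
      tendsto_log_log_natCast_atTop).add_const n⁻¹
  refine h1.congr' ?_
  filter_upwards [hL.eventually_gt_atTop 0, ht.eventually_gt_atTop 0,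
    tendsto_log_log_natCast_atTop.eventually_gt_atTop 0] with k hk htk hkk
  set u := p * (Real.log k / b) ^ n⁻¹ with hu
  have e1 : Real.log (1 + u) = Real.log u + Real.log (1 + 1 / u) := by
    rw [← Real.log_mul htk.ne' (by positivity)]
    congr 1
    field_simp
    ring
  have e2 : Real.log u = Real.log p + n⁻¹ * (Real.log (Real.log k) - Real.log b) := by
    rw [hu, Real.log_mul hp.ne' (by positivity), Real.log_rpow (by positivity),
      Real.log_div hk.ne' hb.ne']
  rw [e1, e2]
  field_simp
  ring

/-- If `K N` grows like `N ^ δ`, passing from `log log K` to `log log N` only adds `log δ`. -/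
theorem tendsto_log_log_div_log_log {δ : ℝ} (hδ : 0 < δ) {K : ℕ → ℕ}
    (hK : Tendsto (fun N : ℕ => (K N : ℝ) / (N : ℝ) ^ δ) atTop (𝓝 1)) :
    Tendsto (fun N : ℕ => Real.log (Real.log (K N)) / Real.log (Real.log N)) atTop (𝓝 1) := by
  have hL : Tendsto (fun k : ℕ => Real.log k) atTop atTop :=
    Real.tendsto_log_atTop.comp tendsto_natCast_atTop_atTop
  have hr : Tendsto (fun N : ℕ => δ + Real.log ((K N : ℝ) / (N : ℝ) ^ δ) / Real.log N)
      atTop (𝓝 δ) := by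
    have h0 := hK.log one_ne_zero
    simpa using (h0.div_atTop hL).const_add δ
  have h1 : Tendsto (fun N : ℕ => 1 + Real.log (δ + Real.log ((K N : ℝ) / (N : ℝ) ^ δ)
      / Real.log N) / Real.log (Real.log N)) atTop (𝓝 1) := by
    simpa using ((hr.log hδ.ne').div_atTop tendsto_log_log_natCast_atTop).const_add 1
  refine h1.congr' ?_
  filter_upwards [hL.eventually_gt_atTop 0, hr.eventually (lt_mem_nhds hδ),
    hK.eventually (lt_mem_nhds one_pos), eventually_gt_atTop 0,
    tendsto_log_log_natCast_atTop.eventually_gt_atTop 0] with N hN hrN hKN hN0 hNN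
  have hN0' : (0 : ℝ) < N := by exact_mod_cast hN0
  have hNδ : 0 < (N : ℝ) ^ δ := Real.rpow_pos_of_pos hN0' δ
  have hK0 : 0 < (K N : ℝ) := by
    have := mul_pos hKN hNδ
    rwa [div_mul_cancel₀ _ hNδ.ne'] at this
  have e1 : Real.log (K N) = Real.log N * (δ + Real.log ((K N : ℝ) / (N : ℝ) ^ δ)
      / Real.log N) := by
    rw [Real.log_div hK0.ne' hNδ.ne', Real.log_rpow hN0']
    field_simp
    ring
  rw [e1, Real.log_mul hN.ne' hrN.ne']
  field_simp

theorem tendsto_atTop_of_tendsto_div_rpow {δ : ℝ} (hδ : 0 < δ) {K : ℕ → ℕ}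
    (hK : Tendsto (fun N : ℕ => (K N : ℝ) / (N : ℝ) ^ δ) atTop (𝓝 1)) :
    Tendsto K atTop atTop := by
  rw [← tendsto_natCast_atTop_iff (R := ℝ)]
  have hN : Tendsto (fun N : ℕ => (N : ℝ) ^ δ) atTop atTop :=
    (tendsto_rpow_atTop hδ).comp tendsto_natCast_atTop_atTop
  refine (hK.pos_mul_atTop one_pos hN).congr' ?_
  filter_upwards [hN.eventually_gt_atTop 0] with N h0
  exact div_mul_cancel₀ _ h0.ne'

theorem isLittleO_natCast_of_tendsto_div_rpow {δ : ℝ} (hδ : δ < 1) {K : ℕ → ℕ}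
    (hK : Tendsto (fun N : ℕ => (K N : ℝ) / (N : ℝ) ^ δ) atTop (𝓝 1)) :
    (fun N : ℕ => (K N : ℝ)) =o[atTop] (fun N : ℕ => (N : ℝ)) := by
  refine isLittleO_of_tendsto' ?_ ?_
  · filter_upwards [eventually_gt_atTop 0] with N hN h0
    exact absurd h0 (by positivity)
  have hN : Tendsto (fun N : ℕ => (N : ℝ) ^ (-(1 - δ))) atTop (𝓝 0) :=
    (tendsto_rpow_neg_atTop (by linarith)).comp tendsto_natCast_atTop_atTop
  have := hK.mul hN
  rw [mul_zero] at this
  refine this.congr' ?_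
  filter_upwards [eventually_gt_atTop 0] with N h0
  have h0' : (0 : ℝ) < N := by exact_mod_cast h0
  rw [show -(1 - δ) = δ - 1 by ring, Real.rpow_sub_one h0'.ne']
  have : (N : ℝ) ^ δ ≠ 0 := (Real.rpow_pos_of_pos h0' δ).ne'
  field_simp

/-- At the threshold `(log k / (4β)) ^ (1 / n)` the tail is at least `k ^ (-1/2)`, so that `k`
independent gains exceed it with probability at least `1 - exp (-√k)`. -/
theorem tendsto_measure_Iic_pow {ν : Measure ℝ} [IsProbabilityMeasure ν] {H : ℝ → ℝ}
    {α β n l η γ : ℝ} (hF : IsClassC (cdf ν) α β n l H η γ) :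
    Tendsto (fun k : ℕ => ν (Set.Iic ((Real.log k / (4 * β)) ^ n⁻¹)) ^ k) atTop (𝓝 0) := by
  have hβ := hF.β_pos
  have hn := hF.n_pos
  have hL : Tendsto (fun k : ℕ => Real.log k) atTop atTop :=
    Real.tendsto_log_atTop.comp tendsto_natCast_atTop_atTop
  have ht : Tendsto (fun k : ℕ => (Real.log k / (4 * β)) ^ n⁻¹) atTop atTop :=
    (tendsto_rpow_atTop (inv_pos.2 hn)).comp (hL.atTop_div_const (by positivity))
  have hlim : Tendsto (fun k : ℕ => ENNReal.ofReal (Real.exp (-Real.sqrt k))) atTop (𝓝 0) := by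
    rw [← ENNReal.ofReal_zero]
    exact ENNReal.tendsto_ofReal (Real.tendsto_exp_neg_atTop_nhds_zero.comp
      (Real.tendsto_sqrt_atTop.comp tendsto_natCast_atTop_atTop))
  refine tendsto_of_tendsto_of_tendsto_of_le_of_le' tendsto_const_nhds hlim
    (Eventually.of_forall fun _ => zero_le) ?_
  filter_upwards [ht.eventually hF.eventually_tail_bounds, hL.eventually_gt_atTop 0,
    eventually_gt_atTop 0] with k hk hlk hk0
  have hk0' : (0 : ℝ) < k := by exact_mod_cast hk0
  have hsq : 0 < Real.sqrt k := Real.sqrt_pos.2 hk0'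
  set t := (Real.log k / (4 * β)) ^ n⁻¹ with htdef
  have e1 : Real.exp (-(2 * β) * t ^ n) = (Real.sqrt k)⁻¹ := by
    rw [htdef, Real.rpow_inv_rpow (by positivity) hn.ne', ← Real.exp_log hsq, ← Real.exp_neg,
      Real.log_sqrt hk0'.le]
    congr 1
    field_simp
    ring
  have e2 : cdf ν t ≤ Real.exp (-(Real.sqrt k)⁻¹) := by
    have h3 := hk.2
    rw [e1] at h3
    have := Real.add_one_le_exp (-(Real.sqrt k)⁻¹)
    linarith
  rw [← ofReal_measureReal (μ := ν), ← cdf_eq_real, ← ENNReal.ofReal_pow (cdf_nonneg ν t)]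
  apply ENNReal.ofReal_le_ofReal
  calc cdf ν t ^ k ≤ Real.exp (-(Real.sqrt k)⁻¹) ^ k :=
        pow_le_pow_left₀ (cdf_nonneg ν t) e2 k
    _ = Real.exp (-Real.sqrt k) := by
        rw [← Real.exp_nat_mul]
        congr 1
        field_simp
        linarith [Real.sq_sqrt hk0'.le]

section Model

variable {Ω : Type*} [MeasurableSpace Ω] {μ : Measure Ω} [IsProbabilityMeasure μ]
  {h g : ℕ → Ω → ℝ}

/-- Squeezing between the threshold policy and the uniform upper bound: the rate is equivalent to
`(1 / n) log log K`. -/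
theorem tendsto_rateSCG_div_log_log (hm : IsFadingModel μ h g)
    {αh βh nh lh : ℝ} {Hh : ℝ → ℝ} {ηh γh : ℝ}
    (hh : IsClassC (cdf (μ.map (h 0))) αh βh nh lh Hh ηh γh)
    (hat : ∀ x, μ.map (g 0) {x} = 0) (hg1 : 0 < μ.map (g 0) (Set.Iic 1))
    {Pave Qave : ℝ} (hP : 0 < Pave) (hQ : 0 < Qave) {K : ℕ → ℕ} (hK : Tendsto K atTop atTop)
    (hKo : (fun N : ℕ => (K N : ℝ)) =o[atTop] (fun N : ℕ => (N : ℝ))) :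
    Tendsto (fun N : ℕ => (rateSCG μ h g Pave Qave N (K N)).toReal /
      Real.log (Real.log (K N))) atTop (𝓝 (1 / nh)) := by
  have hprob := Measure.isProbabilityMeasure_map (μ := μ) (hm.measurable_h 0).aemeasurable
  have hβ := hh.β_pos
  have hn := hh.n_pos
  obtain ⟨D, hD⟩ := exists_rateSCG_le hm hh hat (Qave := Qave) hP.le
  set p := min Pave Qave with hp
  have hp0 : 0 < p := lt_min hP hQ
  set t : ℕ → ℝ := fun k => (Real.log k / (4 * βh)) ^ nh⁻¹ with ht
  set ε : ℕ → ℝ≥0∞ := fun N =>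
    1 - (μ {ω | (Finset.univ.filter fun i => gains N g ω i ≤ 1).card < K N}
        + μ.map (h 0) (Set.Iic (t (K N))) ^ K N) with hε
  have hε1 : Tendsto (fun N => (ε N).toReal) atTop (𝓝 1) := by
    have h0 : Tendsto ε atTop (𝓝 1) := by
      have h1 := ENNReal.Tendsto.sub (tendsto_const_nhds (x := (1 : ℝ≥0∞)))
        ((tendsto_measure_card_lt hm hg1 hKo).add ((tendsto_measure_Iic_pow hh).comp hK))
        (Or.inl ENNReal.one_ne_top)
      simpa using h1
    exact (ENNReal.tendsto_toReal ENNReal.one_ne_top).comp h0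
  have hlow : Tendsto (fun N => Real.log (1 + p * t (K N)) / Real.log (Real.log (K N))
      * (ε N).toReal) atTop (𝓝 (1 / nh)) := by
    simpa using ((tendsto_lower_div_log_log hp0 (show 0 < 4 * βh by positivity) hn).comp hK).mul hε1
  have hupp := (tendsto_upper_div_log_log D (1 / nh)).comp hK
  have hKN : ∀ᶠ N in atTop, K N ≤ N := by
    filter_upwards [hKo.bound one_pos] with N hN
    simpa using hN
  have hupos : ∀ᶠ k : ℕ in atTop,
      0 < (D + 1 / nh * Real.log (1 + Real.log k)) / Real.log (Real.log k) :=
    (tendsto_upper_div_log_log D (1 / nh)).eventually (lt_mem_nhds (by positivity))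
  refine tendsto_of_tendsto_of_tendsto_of_le_of_le' hlow hupp ?_ ?_
  · filter_upwards [hKN, hK.eventually_ge_atTop 1,
      (tendsto_log_log_natCast_atTop.comp hK).eventually_gt_atTop 0] with N hN h1 hll
    have hll' : 0 < Real.log (Real.log (K N)) := hll
    have hlog : 0 ≤ Real.log (K N) := Real.log_nonneg (by exact_mod_cast h1)
    have ht0 : 0 ≤ t (K N) := by positivity
    have hpt : 0 ≤ Real.log (1 + p * t (K N)) :=
      Real.log_nonneg (by linarith [mul_nonneg hp0.le ht0])
    have hb : ENNReal.ofReal (Real.log (1 + p * t (K N))) * ε N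
        ≤ rateSCG μ h g Pave Qave N (K N) :=
      (mul_le_mul_right (one_sub_le_measure_activeUsers hm h1 hN _) _).trans
        (le_rateSCG hm h1 hN hp0.le (min_le_left _ _) (min_le_right _ _) ht0)
    have hfin := ((hD N (K N) h1 hN).trans_lt ENNReal.ofReal_lt_top).ne
    have hr := ENNReal.toReal_mono hfin hb
    rw [ENNReal.toReal_mul, ENNReal.toReal_ofReal hpt] at hr
    rw [div_mul_eq_mul_div]
    exact div_le_div_of_nonneg_right hr hll'.le
  · filter_upwards [hKN, hK.eventually_ge_atTop 1, hK.eventually hupos,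
      (tendsto_log_log_natCast_atTop.comp hK).eventually_gt_atTop 0] with N hN h1 hu hll
    have hll' : 0 < Real.log (Real.log (K N)) := hll
    have hu' := (div_pos_iff_of_pos_right hll').1 hu
    exact div_le_div_of_nonneg_right
      (ENNReal.toReal_le_of_le_ofReal hu'.le (hD N (K N) h1 hN)) hll'.le

theorem tendsto_rateSCG_div_log_log_of_rpow (hm : IsFadingModel μ h g)
    {αh βh nh lh : ℝ} {Hh : ℝ → ℝ} {ηh γh : ℝ}
    (hh : IsClassC (cdf (μ.map (h 0))) αh βh nh lh Hh ηh γh)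
    (hat : ∀ x, μ.map (g 0) {x} = 0) (hg1 : 0 < μ.map (g 0) (Set.Iic 1))
    {Pave Qave : ℝ} (hP : 0 < Pave) (hQ : 0 < Qave) {δ : ℝ} (hδ0 : 0 < δ) (hδ1 : δ < 1)
    {K : ℕ → ℕ} (hK : Tendsto (fun N : ℕ => (K N : ℝ) / (N : ℝ) ^ δ) atTop (𝓝 1)) :
    Tendsto (fun N : ℕ => (rateSCG μ h g Pave Qave N (K N)).toReal /
      Real.log (Real.log N)) atTop (𝓝 (1 / nh)) := by
  have hKt := tendsto_atTop_of_tendsto_div_rpow hδ0 hK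
  have h1 := (tendsto_rateSCG_div_log_log hm hh hat hg1 hP hQ hKt
    (isLittleO_natCast_of_tendsto_div_rpow hδ1 hK)).mul (tendsto_log_log_div_log_log hδ0 hK)
  rw [mul_one] at h1
  refine h1.congr' ?_
  filter_upwards [(tendsto_log_log_natCast_atTop.comp hKt).eventually_gt_atTop 0] with N hN
  exact div_mul_div_cancel₀ (ne_of_gt hN)

theorem tendsto_rateFull_div_log_log (hm : IsFadingModel μ h g)
    {αh βh nh lh : ℝ} {Hh : ℝ → ℝ} {ηh γh : ℝ}
    (hh : IsClassC (cdf (μ.map (h 0))) αh βh nh lh Hh ηh γh)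
    (hat : ∀ x, μ.map (g 0) {x} = 0) (hg1 : 0 < μ.map (g 0) (Set.Iic 1))
    {Pave Qave : ℝ} (hP : 0 < Pave) (hQ : 0 < Qave) :
    Tendsto (fun N : ℕ => (rateFull μ h g Pave Qave N).toReal / Real.log (Real.log N))
      atTop (𝓝 (1 / nh)) := by
  have hn := hh.n_pos
  obtain ⟨D, hD⟩ := exists_rateSCG_le hm hh hat (Qave := Qave) hP.le
  have hupp := tendsto_upper_div_log_log D (1 / nh)
  -- The feedback constraint with `K N = ⌊√N⌋` already costs only `O(1)`.
  have hK : Tendsto (fun N : ℕ => ((⌊(N : ℝ) ^ (1 / 2 : ℝ)⌋₊ : ℕ) : ℝ) / (N : ℝ) ^ (1 / 2 : ℝ))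
      atTop (𝓝 1) :=
    (tendsto_nat_floor_div_atTop (R := ℝ)).comp
      ((tendsto_rpow_atTop (by norm_num)).comp tendsto_natCast_atTop_atTop)
  have hlow := tendsto_rateSCG_div_log_log_of_rpow hm hh hat hg1 hP hQ
    (by norm_num) (by norm_num) hK
  refine tendsto_of_tendsto_of_tendsto_of_le_of_le' hlow hupp ?_ ?_
  · filter_upwards [tendsto_log_log_natCast_atTop.eventually_gt_atTop 0] with N hN
    exact div_le_div_of_nonneg_right (ENNReal.toReal_mono (rateFull_ne_top hm hh hat hP.le N)
      (rateSCG_le_rateFull _ _ _ _ _ _ _)) hN.le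
  · filter_upwards [tendsto_log_log_natCast_atTop.eventually_gt_atTop 0, eventually_ge_atTop 1,
      hupp.eventually (lt_mem_nhds (show 0 < 1 / nh by positivity))] with N hN h1 hu
    rw [rateFull_eq_rateSCG_self]
    exact div_le_div_of_nonneg_right (ENNReal.toReal_le_of_le_ofReal
      ((div_pos_iff_of_pos_right hN).1 hu).le (hD N N h1 le_rfl)) hN.le

end Model

end CMAC

theorem theorem1 {Ω : Type*} [MeasurableSpace Ω] (μ : Measure Ω) [IsProbabilityMeasure μ]
    (h g : ℕ → Ω → ℝ) (hmodel : CMAC.IsFadingModel μ h g)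
    (αh βh nh lh : ℝ) (Hh : ℝ → ℝ) (ηh γh : ℝ)
    (hh : CMAC.IsClassC (cdf (μ.map (h 0))) αh βh nh lh Hh ηh γh)
    (αg βg ng lg : ℝ) (Hg : ℝ → ℝ) (ηg γg : ℝ)
    (hg : CMAC.IsClassC (cdf (μ.map (g 0))) αg βg ng lg Hg ηg γg)
    (Pave Qave : ℝ) (hP : 0 < Pave) (hQ : 0 < Qave) :
    -- all optimal sum-rates are finite
    (∀ N : ℕ, CMAC.rateFull μ h g Pave Qave N ≠ ∞ ∧
      ∀ k : ℕ, CMAC.rateSCG μ h g Pave Qave N k ≠ ∞) ∧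
    -- scaling under `K`-smallest-channel-gains feedback
    (∀ K : ℕ → ℕ, Tendsto K atTop atTop →
      (fun N : ℕ => (K N : ℝ)) =o[atTop] (fun N : ℕ => (N : ℝ)) →
      Tendsto (fun N : ℕ => (CMAC.rateSCG μ h g Pave Qave N (K N)).toReal /
        Real.log (Real.log (K N))) atTop (𝓝 (1 / nh))) ∧
    -- scaling under full feedback
    Tendsto (fun N : ℕ => (CMAC.rateFull μ h g Pave Qave N).toReal /
      Real.log (Real.log N)) atTop (𝓝 (1 / nh)) ∧
    -- asymptotic optimality of `K N = N ^ δ` (up to rounding)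
    (∀ δ : ℝ, 0 < δ → δ < 1 → ∀ K : ℕ → ℕ,
      Tendsto (fun N : ℕ => (K N : ℝ) / (N : ℝ) ^ δ) atTop (𝓝 1) →
      Tendsto (fun N : ℕ => (CMAC.rateSCG μ h g Pave Qave N (K N)).toReal /
        Real.log (Real.log N)) atTop (𝓝 (1 / nh)) ∧
      Tendsto (fun N : ℕ => (CMAC.rateSCG μ h g Pave Qave N (K N)).toReal /
        (CMAC.rateFull μ h g Pave Qave N).toReal) atTop (𝓝 1)) := by
  have hprob := Measure.isProbabilityMeasure_map (μ := μ) (hmodel.measurable_g 0).aemeasurable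
  have hat := hg.measure_singleton
  have hg1 : 0 < μ.map (g 0) (Set.Iic 1) := by
    have := hg.cdf_pos one_pos
    rw [cdf_eq_real] at this
    exact (ENNReal.toReal_pos_iff.1 this).1
  have hfull := CMAC.tendsto_rateFull_div_log_log hmodel hh hat hg1 hP hQ
  have hn := hh.n_pos
  refine ⟨fun N => ?_, fun K hK hKo =>
    CMAC.tendsto_rateSCG_div_log_log hmodel hh hat hg1 hP hQ hK hKo, hfull,
    fun δ hδ0 hδ1 K hK => ?_⟩
  · have hN := CMAC.rateFull_ne_top hmodel hh hat (Qave := Qave) hP.le N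
    exact ⟨hN, fun k => ne_top_of_le_ne_top hN (CMAC.rateSCG_le_rateFull _ _ _ _ _ _ _)⟩
  · have hscg := CMAC.tendsto_rateSCG_div_log_log_of_rpow hmodel hh hat hg1 hP hQ hδ0 hδ1 hK
    refine ⟨hscg, ?_⟩
    have hdiv := hscg.div hfull (by positivity)
    rw [div_self (by positivity)] at hdiv
    refine hdiv.congr' ?_
    filter_upwards [CMAC.tendsto_log_log_natCast_atTop.eventually_gt_atTop 0] with N hN
    exact div_div_div_cancel_right₀ hN.ne' _ _
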